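/- Let $p>2$ and $K\in\mathbb{R}$. There is a constant $C(p,K)>0$, depending only on $p$ and $K$, such that the following holds. Let $n$ be a natural number and let $B$ be an $n\times n$ symmetric positive semidefinite real random matrix with spectral decomposition $B=UDU^t$, where $U$ is a random orthogonal matrix and $D=\mathrm{diag}(\alpha_1,\dots,\alpha_n)$ is a random diagonal matrix. Suppose that $U$ and $D$ are independent, that the random variables $\alpha_1,\dots,\alpha_n$ are independent, and that $$\mathbb{E}\,\alpha_i=1\quad\text{and}\quad\left(\mathbb{E}\,\alpha_i^p\right)^{1/p}\leqslant K\qquad\text{for all } i\leqslant n.$$ Let $\varepsilon\in(0,1)$, let $N$ be any natural number with $$N\geqslant C(p,K)\,\frac{n}{\varepsilon^{\frac{2p}{p-2}}},$$ and let $B_1,\dots,B_N$ be independent copies of $B$. Then $$\mathbb{E}\left\Vert \frac1N\sum_{i=1}^N B_i-I_n\right\Vert\leqslant\varepsilon,$$ where $\Vert\cdot\Vert$ is the operator norm on $\mathbb{R}^n$ with its Euclidean norm (and this expectation is that of an integrable random variable). -/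

import Mathlib

open MeasureTheory ProbabilityTheory

/-- The product (entrywise) σ-algebra on real matrices, that is, the Borel σ-algebra. -/
instance instMeasurableSpaceRealMatrix (m n : Type*) : MeasurableSpace (Matrix m n ℝ) :=
  inferInstanceAs (MeasurableSpace (m → n → ℝ))

/-! A second-moment bound in the Frobenius norm suffices. Put $T=\frac1N\sum_i B_i-I$. Its entries
are centred averages of independent copies, so $\mathbb
E\|T\|_F^2=\frac1N\sum_{k,l}\mathrm{Var}(B_{kl})$. Since $B-I=U(D-I)U^t$ and the Frobenius norm is
invariant under orthogonal conjugation, the sum of variances is $\sum_i\mathrm{Var}(\alpha_i)\le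
nK^2$. Hence $\mathbb E\|T\|\le(nK^2/N)^{1/2}$ (`integral_norm_average_sub_one_le`,
`conj_diagonal_entry_moments`). This needs only $N\ge K^2n/\varepsilon^2$, which the assumed bound
on $N$ implies because $2p/(p-2)\ge2$ and $\varepsilon<1$. -/

/-- The Euclidean operator norm is at most the Frobenius norm. -/
theorem norm_toEuclideanCLM_sq_le {n : Type*} [Fintype n] [DecidableEq n] (M : Matrix n n ℝ) :
    ‖Matrix.toEuclideanCLM (n := n) (𝕜 := ℝ) M‖ ^ 2 ≤ ∑ k, ∑ l, M k l ^ 2 := by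
  have hnn : 0 ≤ ∑ k, ∑ l, M k l ^ 2 :=
    Finset.sum_nonneg fun k _ => Finset.sum_nonneg fun l _ => sq_nonneg _
  rw [← Real.le_sqrt (norm_nonneg _) hnn]
  refine ContinuousLinearMap.opNorm_le_bound _ (Real.sqrt_nonneg _) fun x => ?_
  refine le_of_sq_le_sq ?_ (by positivity)
  rw [mul_pow, Real.sq_sqrt hnn, EuclideanSpace.norm_sq_eq, EuclideanSpace.norm_sq_eq,
    Finset.sum_mul]
  refine Finset.sum_le_sum fun k _ => ?_
  simp only [Matrix.ofLp_toEuclideanCLM, Matrix.mulVec, dotProduct, Real.norm_eq_abs, sq_abs]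
  exact Finset.sum_mul_sq_le_sq_mul_sq _ _ _

theorem continuous_norm_toEuclideanCLM (n : Type*) [Fintype n] [DecidableEq n] :
    Continuous fun M : Matrix n n ℝ => ‖Matrix.toEuclideanCLM (n := n) (𝕜 := ℝ) M‖ :=
  continuous_norm.comp (LinearMap.continuous_of_finiteDimensional
    (Matrix.toEuclideanCLM (n := n) (𝕜 := ℝ)).toAlgEquiv.toLinearMap)

theorem measurable_norm_toEuclideanCLM (n : Type*) [Fintype n] [DecidableEq n] :
    Measurable fun M : Matrix n n ℝ => ‖Matrix.toEuclideanCLM (n := n) (𝕜 := ℝ) M‖ :=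
  Continuous.measurable (α := n → n → ℝ) (continuous_norm_toEuclideanCLM n)

theorem measurable_matrix_apply {m n : Type*} (k : m) (l : n) :
    Measurable fun M : Matrix m n ℝ => M k l :=
  (measurable_pi_apply l).comp (measurable_pi_apply (X := fun _ : m => n → ℝ) k)

theorem aemeasurable_matrix {m n Ω : Type*} [Countable m] [Countable n] [MeasurableSpace Ω]
    {μ : Measure Ω} {T : Ω → Matrix m n ℝ} (hT : ∀ k l, AEMeasurable (fun ω => T ω k l) μ) :
    AEMeasurable T μ :=
  aemeasurable_pi_lambda (X := fun _ : m => n → ℝ) (fun ω => T ω) fun k =>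
    aemeasurable_pi_lambda (X := fun _ : n => ℝ) (fun ω => T ω k) (hT k)

/-- The sum is $\mathrm{tr}(MM^t)$, and cyclicity of the trace removes $U$. It is used with
$a_i=\alpha_i-1$. -/
theorem sum_sq_conj_diagonal {n : Type*} [Fintype n] [DecidableEq n] {U : Matrix n n ℝ}
    (hU : U ∈ Matrix.orthogonalGroup n ℝ) (a : n → ℝ) :
    ∑ k, ∑ l, (U * Matrix.diagonal a * U.transpose) k l ^ 2 = ∑ i, a i ^ 2 := by
  have h1 : U.transpose * U = 1 := by
    simpa [Matrix.star_eq_conjTranspose] using (Matrix.mem_orthogonalGroup_iff' n ℝ).1 hU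
  set M := U * Matrix.diagonal a * U.transpose with hM
  have h2 : ∑ k, ∑ l, M k l ^ 2 = (M * M.transpose).trace := by
    simp [Matrix.trace, Matrix.mul_apply, sq]
  have h3 : M * M.transpose = U * (Matrix.diagonal a * Matrix.diagonal a * U.transpose) := by
    rw [hM]
    simp only [Matrix.transpose_mul, Matrix.transpose_transpose, Matrix.diagonal_transpose,
      Matrix.mul_assoc]
    rw [← Matrix.mul_assoc U.transpose U, h1, Matrix.one_mul]
  rw [h2, h3, Matrix.trace_mul_comm, Matrix.mul_assoc, h1, Matrix.mul_one,
    Matrix.diagonal_mul_diagonal, Matrix.trace_diagonal]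
  simp [sq]

/-- Lyapunov's inequality between the second moment and the `p`-th moment. -/
theorem integral_sq_le_of_moment_le {Ω : Type*} [MeasurableSpace Ω] {μ : Measure Ω}
    [IsProbabilityMeasure μ] {p K : ℝ} (hp : 2 ≤ p) {X : Ω → ℝ} (h0 : ∀ᵐ ω ∂μ, 0 ≤ X ω)
    (hX : MemLp X (ENNReal.ofReal p) μ) (hK : (∫ ω, X ω ^ p ∂μ) ^ (1 / p) ≤ K) :
    MemLp X 2 μ ∧ ∫ ω, X ω ^ 2 ∂μ ≤ K ^ 2 := by
  have hp0 : 0 < p := by linarith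
  have h2p : (2 : ENNReal) ≤ ENNReal.ofReal p := by
    rw [← ENNReal.ofReal_ofNat]; exact ENNReal.ofReal_le_ofReal hp
  have h2 : MemLp X 2 μ := hX.mono_exponent h2p
  refine ⟨h2, ?_⟩
  have hle := eLpNorm_le_eLpNorm_of_exponent_le h2p hX.1
  rw [h2.eLpNorm_eq_integral_rpow_norm (by norm_num) (by norm_num),
    hX.eLpNorm_eq_integral_rpow_norm (by simpa using hp0) (by simp),
    ENNReal.toReal_ofReal hp0.le] at hle
  have hpn : ∫ ω, ‖X ω‖ ^ p ∂μ = ∫ ω, X ω ^ p ∂μ :=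
    integral_congr_ae (h0.mono fun ω h => by simp [abs_of_nonneg h])
  have hpnn : 0 ≤ (∫ ω, X ω ^ p ∂μ) ^ (1 / p) := by
    rw [← hpn]; positivity
  have h2n : ∫ ω, ‖X ω‖ ^ (2 : ENNReal).toReal ∂μ = ∫ ω, X ω ^ 2 ∂μ := by simp
  rw [h2n, hpn, ← one_div p, ENNReal.ofReal_le_ofReal_iff hpnn] at hle
  have hs : √(∫ ω, X ω ^ 2 ∂μ) ≤ K := by
    rw [Real.sqrt_eq_rpow]
    simpa using hle.trans hK
  exact (Real.sqrt_le_left (hpnn.trans hK)).1 hs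

/-- Averages of independent copies of a random matrix with mean `1` concentrate around `1`. -/
theorem integral_norm_average_sub_one_le {n : Type*} [Fintype n] [DecidableEq n]
    {Ω : Type*} [MeasurableSpace Ω] {μ : Measure Ω} {B : Ω → Matrix n n ℝ} {V : ℝ}
    (hB : ∀ k l, MemLp (fun ω => B ω k l) 2 μ)
    (hmean : ∀ k l, ∫ ω, B ω k l ∂μ = (1 : Matrix n n ℝ) k l)
    (hV : ∑ k, ∑ l, Var[fun ω => B ω k l; μ] ≤ V)
    {N : ℕ} (hN : 0 < N)
    {Ω' : Type*} [MeasurableSpace Ω'] {ν : Measure Ω'} [IsProbabilityMeasure ν]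
    {Bs : Fin N → Ω' → Matrix n n ℝ} (hind : iIndepFun Bs ν)
    (hid : ∀ i, IdentDistrib (Bs i) B ν μ) :
    Integrable (fun ω => ‖Matrix.toEuclideanCLM (n := n) (𝕜 := ℝ)
      ((1 / (N : ℝ)) • ∑ i, Bs i ω - 1)‖) ν ∧
    ∫ ω, ‖Matrix.toEuclideanCLM (n := n) (𝕜 := ℝ)
      ((1 / (N : ℝ)) • ∑ i, Bs i ω - 1)‖ ∂ν ≤ √(V / N) := by
  have hN' : (0 : ℝ) < N := by exact_mod_cast hN
  set T : Ω' → Matrix n n ℝ := fun ω => (1 / (N : ℝ)) • ∑ i, Bs i ω - 1 with hT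
  have hidkl : ∀ i k l, IdentDistrib (fun ω => Bs i ω k l) (fun ω => B ω k l) ν μ :=
    fun i k l => (hid i).comp (measurable_matrix_apply k l)
  have hBs : ∀ i k l, MemLp (fun ω => Bs i ω k l) 2 ν :=
    fun i k l => (hidkl i k l).memLp_iff.2 (hB k l)
  have hTkl : ∀ k l, (fun ω => T ω k l) =
      fun ω => (1 / (N : ℝ)) * (∑ i, fun ω => Bs i ω k l) ω - (1 : Matrix n n ℝ) k l := by
    intro k l
    ext ω
    simp [hT, Matrix.sum_apply]
  have hsum : ∀ k l, MemLp (∑ i, fun ω => Bs i ω k l) 2 ν :=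
    fun k l => memLp_finsetSum' _ fun i _ => hBs i k l
  have hTmem : ∀ k l, MemLp (fun ω => T ω k l) 2 ν := by
    intro k l
    rw [hTkl]
    exact ((hsum k l).const_mul _).sub (memLp_const _)
  have hTsq : ∀ k l, ∫ ω, T ω k l ^ 2 ∂ν = Var[fun ω => B ω k l; μ] / N := by
    intro k l
    have hm : ∫ ω, (1 / (N : ℝ)) * (∑ i, fun ω => Bs i ω k l) ω ∂ν = (1 : Matrix n n ℝ) k l := by
      rw [integral_const_mul]
      simp only [Finset.sum_apply]
      rw [integral_finsetSum _ fun i _ => (hBs i k l).integrable (by norm_num)]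
      simp only [(hidkl _ k l).integral_eq, hmean]
      simp
      field_simp
    have hvar : Var[fun ω => (1 / (N : ℝ)) * (∑ i, fun ω => Bs i ω k l) ω; ν] =
        Var[fun ω => B ω k l; μ] / N := by
      rw [variance_const_mul, IndepFun.variance_sum (fun i _ => hBs i k l)
        fun i _ j _ hij => (hind.indepFun hij).comp (measurable_matrix_apply k l)
          (measurable_matrix_apply k l)]
      simp only [(hidkl _ k l).variance_eq]
      simp
      field_simp
    rw [← hvar, variance_eq_integral ((hsum k l).const_mul _).1.aemeasurable, hm]
    exact integral_congr_ae (Filter.Eventually.of_forall fun ω => by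
      simp only [congrFun (hTkl k l) ω])
  have hTae : AEMeasurable T ν := aemeasurable_matrix fun k l => (hTmem k l).1.aemeasurable
  have hsm : AEStronglyMeasurable
      (fun ω => ‖Matrix.toEuclideanCLM (n := n) (𝕜 := ℝ) (T ω)‖) ν :=
    ((measurable_norm_toEuclideanCLM n).comp_aemeasurable hTae).aestronglyMeasurable
  have hint : Integrable (fun ω => ∑ k, ∑ l, T ω k l ^ 2) ν :=
    integrable_finsetSum _ fun k _ => integrable_finsetSum _ fun l _ => (hTmem k l).integrable_sq
  have hmem : MemLp (fun ω => ‖Matrix.toEuclideanCLM (n := n) (𝕜 := ℝ) (T ω)‖) 2 ν := by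
    rw [memLp_two_iff_integrable_sq hsm]
    refine hint.mono' (hsm.pow 2) (Filter.Eventually.of_forall fun ω => ?_)
    rw [Real.norm_of_nonneg (sq_nonneg _)]
    exact norm_toEuclideanCLM_sq_le _
  refine ⟨hmem.integrable (by norm_num), Real.le_sqrt_of_sq_le ?_⟩
  -- Nonnegativity of the variance gives $(\mathbb E X)^2\le\mathbb E X^2$.
  have hvar := variance_nonneg (fun ω => ‖Matrix.toEuclideanCLM (n := n) (𝕜 := ℝ) (T ω)‖) ν
  rw [variance_eq_sub hmem, sub_nonneg] at hvar
  refine hvar.trans ?_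
  calc ∫ ω, ‖Matrix.toEuclideanCLM (n := n) (𝕜 := ℝ) (T ω)‖ ^ 2 ∂ν
      ≤ ∫ ω, ∑ k, ∑ l, T ω k l ^ 2 ∂ν :=
        integral_mono hmem.integrable_sq hint fun ω => norm_toEuclideanCLM_sq_le _
    _ = (∑ k, ∑ l, Var[fun ω => B ω k l; μ]) / N := by
        rw [integral_finsetSum _ fun k _ =>
          integrable_finsetSum _ fun l _ => (hTmem k l).integrable_sq, Finset.sum_div]
        refine Finset.sum_congr rfl fun k _ => ?_
        rw [integral_finsetSum _ fun l _ => (hTmem k l).integrable_sq, Finset.sum_div]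
        exact Finset.sum_congr rfl fun l _ => hTsq k l
    _ ≤ V / N := by gcongr

/-- Entrywise moments of `U D Uᵀ` for independent orthogonal `U` and diagonal `D` of mean `1`. -/
theorem conj_diagonal_entry_moments {n : Type*} [Fintype n] [DecidableEq n]
    {Ω : Type*} [MeasurableSpace Ω] {μ : Measure Ω} [IsProbabilityMeasure μ]
    {B U : Ω → Matrix n n ℝ} {α : n → Ω → ℝ} (hUm : Measurable U)
    (hU : ∀ᵐ ω ∂μ, U ω ∈ Matrix.orthogonalGroup n ℝ)
    (hB : ∀ᵐ ω ∂μ, B ω = U ω * Matrix.diagonal (fun i => α i ω) * (U ω).transpose)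
    (hind : IndepFun U (fun ω => Matrix.diagonal (fun i => α i ω)) μ)
    (hα : ∀ i, MemLp (α i) 2 μ) (hmean : ∀ i, ∫ ω, α i ω ∂μ = 1) :
    (∀ k l, MemLp (fun ω => B ω k l) 2 μ) ∧
    (∀ k l, ∫ ω, B ω k l ∂μ = (1 : Matrix n n ℝ) k l) ∧
    ∑ k, ∑ l, Var[fun ω => B ω k l; μ] = ∑ i, Var[α i; μ] := by
  have hUkl : ∀ k l, Measurable fun ω => U ω k l :=
    fun k l => (measurable_matrix_apply k l).comp hUm
  have hentry : ∀ k l, (fun ω => B ω k l) =ᵐ[μ] fun ω => ∑ i, (U ω k i * U ω l i) * α i ω := by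
    intro k l
    filter_upwards [hB] with ω h
    rw [h, Matrix.mul_apply]
    simp only [Matrix.mul_diagonal, Matrix.transpose_apply]
    exact Finset.sum_congr rfl fun i _ => by ring
  -- Entries of an orthogonal matrix are at most 1 in absolute value, so each term inherits square
  -- integrability from $\alpha_i$.
  have hbdd : ∀ k l i, ∀ᵐ ω ∂μ, ‖U ω k i * U ω l i‖ ≤ 1 := by
    intro k l i
    filter_upwards [hU] with ω h
    rw [norm_mul]
    exact mul_le_one₀ (entry_norm_bound_of_unitary h k i) (norm_nonneg _)
      (entry_norm_bound_of_unitary h l i)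
  have hterm : ∀ k l i, MemLp (fun ω => (U ω k i * U ω l i) * α i ω) 2 μ := by
    intro k l i
    refine (hα i).mono (((hUkl k i).mul (hUkl l i)).aestronglyMeasurable.mul (hα i).1) ?_
    filter_upwards [hbdd k l i] with ω h
    rw [norm_mul]
    exact mul_le_of_le_one_left (norm_nonneg _) h
  have hmem : ∀ k l, MemLp (fun ω => B ω k l) 2 μ := fun k l =>
    (memLp_congr_ae (hentry k l)).2 (memLp_finsetSum _ fun i _ => hterm k l i)
  have hBmean : ∀ k l, ∫ ω, B ω k l ∂μ = (1 : Matrix n n ℝ) k l := by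
    intro k l
    have hUU : ∀ i, Integrable (fun ω => U ω k i * U ω l i) μ := fun i =>
      (integrable_const (1 : ℝ)).mono' ((hUkl k i).mul (hUkl l i)).aestronglyMeasurable (hbdd k l i)
    -- Independence and $\mathbb E\alpha_i=1$ replace $D$ by $I$ in the mean, leaving $\mathbb
    -- E[UU^t]=I$.
    have hprod : ∀ i, ∫ ω, (U ω k i * U ω l i) * α i ω ∂μ = ∫ ω, U ω k i * U ω l i ∂μ := by
      intro i
      have hi : IndepFun (fun ω => U ω k i * U ω l i) (α i) μ := by
        have := hind.comp (φ := fun M : Matrix n n ℝ => M k i * M l i)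
          (ψ := fun M : Matrix n n ℝ => M i i)
          ((measurable_matrix_apply k i).mul (measurable_matrix_apply l i))
          (measurable_matrix_apply i i)
        simpa [Function.comp_def] using this
      rw [hi.integral_fun_mul_eq_mul_integral ((hUkl k i).mul (hUkl l i)).aestronglyMeasurable
        (hα i).1, hmean, mul_one]
    rw [integral_congr_ae (hentry k l),
      integral_finsetSum _ fun i _ => (hterm k l i).integrable (by norm_num),
      Finset.sum_congr rfl fun i _ => hprod i, ← integral_finsetSum _ fun i _ => hUU i]
    have : (fun ω => ∑ i, U ω k i * U ω l i) =ᵐ[μ] fun _ => (1 : Matrix n n ℝ) k l := by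
      filter_upwards [hU] with ω h
      have h1 := (Matrix.mem_orthogonalGroup_iff n ℝ).1 h
      rw [← h1]
      simp [Matrix.mul_apply]
    rw [integral_congr_ae this]
    simp
  refine ⟨hmem, hBmean, ?_⟩
  have hsq : ∀ k l, Integrable (fun ω => (B ω k l - (1 : Matrix n n ℝ) k l) ^ 2) μ :=
    fun k l => ((hmem k l).sub (memLp_const _)).integrable_sq
  have hsqα : ∀ i, Integrable (fun ω => (α i ω - 1) ^ 2) μ :=
    fun i => ((hα i).sub (memLp_const _)).integrable_sq
  -- Both sides become expectations of sums of squares, which agree pointwise almost surely.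
  simp only [variance_eq_integral (hmem _ _).1.aemeasurable,
    variance_eq_integral (hα _).1.aemeasurable, hBmean, hmean]
  rw [← integral_finsetSum _ fun i _ => hsqα i]
  simp only [← integral_finsetSum _ fun l _ => hsq _ l]
  rw [← integral_finsetSum _ fun k _ => integrable_finsetSum _ fun l _ => hsq k l]
  refine integral_congr_ae ?_
  filter_upwards [hU, hB] with ω h hb
  rw [← sum_sq_conj_diagonal h]
  have h1 : U ω * (U ω).transpose = 1 := by
    simpa [Matrix.star_eq_conjTranspose] using (Matrix.mem_orthogonalGroup_iff n ℝ).1 h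
  have h2 : U ω * Matrix.diagonal (fun i => α i ω - 1) * (U ω).transpose = B ω - 1 := by
    have : Matrix.diagonal (fun i => α i ω - 1) =
        Matrix.diagonal (fun i => α i ω) - (1 : Matrix n n ℝ) := by
      rw [← Matrix.diagonal_one, Matrix.diagonal_sub]
    rw [this, Matrix.mul_sub, Matrix.sub_mul, Matrix.mul_one, h1, ← hb]
  rw [h2]
  rfl

/-- Conjugating back by $U$ shows that the diagonal matrix is itself positive semidefinite.
Nonnegativity identifies $\mathbb E\alpha_i^p$ with $\mathbb E|\alpha_i|^p$. -/
theorem nonneg_of_posSemidef_conj_diagonal {n : Type*} [Fintype n] [DecidableEq n]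
    {U : Matrix n n ℝ} (hU : U ∈ Matrix.orthogonalGroup n ℝ) {a : n → ℝ}
    (h : (U * Matrix.diagonal a * U.transpose).PosSemidef) (i : n) : 0 ≤ a i := by
  have h1 : U.transpose * U = 1 := by
    simpa [Matrix.star_eq_conjTranspose] using (Matrix.mem_orthogonalGroup_iff' n ℝ).1 hU
  have h2 : U.transpose * (U * Matrix.diagonal a * U.transpose) * U = Matrix.diagonal a := by
    rw [← Matrix.mul_assoc, ← Matrix.mul_assoc, h1, Matrix.one_mul, Matrix.mul_assoc, h1,
      Matrix.mul_one]
  have h3 := h.conjTranspose_mul_mul_same U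
  rw [Matrix.conjTranspose_eq_transpose_of_trivial, h2] at h3
  simpa using h3.diag_nonneg (i := i)

theorem mainTheorem11 (p : ℝ) (hp : 2 < p) (K : ℝ) :
    -- the constant depends only on `p` and on the moment bound `K`
    ∃ C : ℝ, 0 < C ∧
      ∀ (n : ℕ) {Ω : Type*} [MeasurableSpace Ω] (μ : Measure Ω) [IsProbabilityMeasure μ]
        (B U : Ω → Matrix (Fin n) (Fin n) ℝ) (α : Fin n → Ω → ℝ),
        Measurable U → (∀ i, Measurable (α i)) →
        -- `B = U D Uᵀ` is positive semidefinite, `U` orthogonal, `D = diag (α₁, …, αₙ)`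
        (∀ᵐ ω ∂μ, (B ω).PosSemidef) →
        (∀ᵐ ω ∂μ, U ω ∈ Matrix.orthogonalGroup (Fin n) ℝ) →
        (∀ᵐ ω ∂μ, B ω = U ω * Matrix.diagonal (fun i => α i ω) * (U ω).transpose) →
        IndepFun U (fun ω => Matrix.diagonal (fun i => α i ω)) μ →
        iIndepFun α μ →
        (∀ i, Integrable (α i) μ ∧ ∫ ω, α i ω ∂μ = 1) →
        (∀ i, MemLp (α i) (ENNReal.ofReal p) μ ∧ (∫ ω, α i ω ^ p ∂μ) ^ (1 / p) ≤ K) →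
        ∀ ε : ℝ, 0 < ε → ε < 1 →
        ∀ N : ℕ, C * (n / ε ^ (2 * p / (p - 2))) ≤ N →
        ∀ {Ω' : Type*} [MeasurableSpace Ω'] (ν : Measure Ω') [IsProbabilityMeasure ν]
          (Bs : Fin N → Ω' → Matrix (Fin n) (Fin n) ℝ),
          iIndepFun Bs ν → (∀ i, IdentDistrib (Bs i) B ν μ) →
          -- `‖Matrix.toEuclideanCLM M‖` is the operator norm of `M` on Euclidean space
          Integrable (fun ω => ‖Matrix.toEuclideanCLM (n := Fin n) (𝕜 := ℝ)
            ((1 / (N : ℝ)) • ∑ i, Bs i ω - 1)‖) ν ∧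
          ∫ ω, ‖Matrix.toEuclideanCLM (n := Fin n) (𝕜 := ℝ)
            ((1 / (N : ℝ)) • ∑ i, Bs i ω - 1)‖ ∂ν ≤ ε := by
  -- $K^2$ bounds the second moments; the added 1 keeps the constant positive when $K=0$.
  refine ⟨K ^ 2 + 1, by positivity, ?_⟩
  intro n Ω _ μ _ B U α hUm _ hpos hU hB hUD _ hmean hmom ε hε hε1 N hN Ω' _ ν _ Bs hind hid
  have h0 : ∀ i, ∀ᵐ ω ∂μ, 0 ≤ α i ω := by
    intro i
    filter_upwards [hpos, hU, hB] with ω h1 h2 h3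
    exact nonneg_of_posSemidef_conj_diagonal h2 (h3 ▸ h1) i
  have hsq := fun i => integral_sq_le_of_moment_le hp.le (h0 i) (hmom i).1 (hmom i).2
  obtain ⟨hmem, hBmean, hvar⟩ :=
    conj_diagonal_entry_moments hUm hU hB hUD (fun i => (hsq i).1) fun i => (hmean i).2
  have hV : ∑ k, ∑ l, Var[fun ω => B ω k l; μ] ≤ n * K ^ 2 := by
    rw [hvar]
    calc ∑ i, Var[α i; μ] ≤ ∑ _i : Fin n, K ^ 2 :=
          Finset.sum_le_sum fun i _ =>
            (variance_le_expectation_sq (hsq i).1.1).trans (by simpa using (hsq i).2)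
      _ = n * K ^ 2 := by simp
  -- For $n=0$ the bound allows $N=0$, but every operator is zero.
  rcases Nat.eq_zero_or_pos n with rfl | hn
  · simp [Subsingleton.elim _ (0 : EuclideanSpace ℝ (Fin 0) →L[ℝ] EuclideanSpace ℝ (Fin 0)), hε.le]
  have hn' : (0 : ℝ) < n := by exact_mod_cast hn
  have hεp : ε ^ (2 * p / (p - 2)) ≤ ε ^ 2 := by
    rw [← Real.rpow_two]
    refine Real.rpow_le_rpow_of_exponent_ge hε hε1.le ?_
    rw [le_div_iff₀ (by linarith)]
    linarith
  have hN0 : (0 : ℝ) < N :=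
    lt_of_lt_of_le (mul_pos (by positivity) (div_pos hn' (Real.rpow_pos_of_pos hε _))) hN
  obtain ⟨hint, hle⟩ := integral_norm_average_sub_one_le hmem hBmean hV
    (by exact_mod_cast hN0) hind hid
  refine ⟨hint, hle.trans (Real.sqrt_le_iff.2 ⟨hε.le, ?_⟩)⟩
  have h1 : (K ^ 2 + 1) * (n / ε ^ 2) ≤ N := by
    refine le_trans ?_ hN
    gcongr
  rw [← mul_div_assoc, div_le_iff₀ (by positivity)] at h1
  rw [div_le_iff₀ hN0]
  nlinarith
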